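/- An \emph{online problem with binary predictions} $P$ has instances $I=(x,\hat x,r)$ of finite length $n$: true bits $x\in\{0,1\}^n$, predicted bits $\hat x\in\{0,1\}^n$ and requests $r=(r_1,\dots,r_n)$. A (deterministic online) algorithm answers the $i$-th request with a bit $y_i$ that depends only on $r_1,\dots,r_i$ and $\hat x_1,\dots,\hat x_i$. Each answer string has a cost (minimization problem) or a profit (maximization problem) on $I$; write $\mathrm{Alg}(I)$ for the cost or profit of the answers of $\mathrm{Alg}$, and $\mathrm{Opt}(I)$ for the minimum cost or maximum profit over all answer strings $y\in\{0,1\}^n$. Let $$\mu_0(I)=\sum_{i=1}^n x_i(1-\hat x_i),\qquad \mu_1(I)=\sum_{i=1}^n (1-x_i)\hat x_i .$$ For real $\alpha,\beta,\gamma\ge 0$, $\mathrm{Alg}$ is \emph{$(\alpha,\beta,\gamma)$-competitive} for $P$ with respect to $(\mu_0,\mu_1)$ if there is $\kappa\in\mathbb R$ such that for all instances $I$ of $P$ $$\mathrm{Alg}(I)\le \alpha\,\mathrm{Opt}(I)+\beta\mu_0(I)+\gamma\mu_1(I)+\kappa\quad\text{if $P$ is a minimization problem,}$$ $$\mathrm{Opt}(I)\le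 \alpha\,\mathrm{Alg}(I)+\beta\mu_0(I)+\gamma\mu_1(I)+\kappa\quad\text{if $P$ is a maximization problem,}$$ where $\alpha\cdot(-\infty)=-\infty$ also for $\alpha=0$. There are no $(\alpha,\beta,\gamma)$-competitive algorithms when one of $\alpha,\beta,\gamma$ is negative. An $(\alpha,\beta,\gamma)$-competitive algorithm is \emph{Pareto-optimal} if for no $\varepsilon>0$ is there an $(\alpha-\varepsilon,\beta,\gamma)$-, an $(\alpha,\beta-\varepsilon,\gamma)$- or an $(\alpha,\beta,\gamma-\varepsilon)$-competitive algorithm for $P$. A problem $Q$ is \emph{as hard as} $P$ with respect to $(\mu_0,\mu_1)$ if, for all $\alpha,\beta,\gamma$, the existence of an $(\alpha,\beta,\gamma)$-competitive Pareto-optimal algorithm for $Q$ implies the existence of an $(\alpha,\beta,\gamma)$-competitive algorithm for $P$; $Q$ is \emph{exactly as hard as} $P$ if each of them is as hard as the other. Let $t$ be a positive integer. \emph{$(1,t)$-Asymmetric String Guessing with Unknown History and Predictions} ($\mathrm{ASG}_t$) is the minimization problem whose instances are all triples $(x,\hat x,r)$ in which every request $r_i$ is just a prompt to guess the next bit, carrying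 no information, and in which answering $y$ costs $\sum_{i=1}^n\bigl(y_i+t\,x_i(1-y_i)\bigr)$. \emph{Online $t$-Bounded Degree Independent Set with Predictions} ($\mathrm{BDIS}_t$) is the maximization problem in which request $r_i$ reveals a vertex $v_i$ together with its neighbours among $v_1,\dots,v_{i-1}$. The instances are the triples $(x,\hat x,r)$ for which the resulting simple graph $G$ on $\{v_1,\dots,v_n\}$ has maximum degree at most $t$ and $\{v_i : x_i=0\}$ is a maximum independent set of $G$. The profit of answering $y$ is $\sum_{i=1}^n(1-y_i)$ if $\{v_i : y_i=0\}$ is independent in $G$, and $-\infty$ otherwise. \textbf{Theorem.} For every positive integer $t$, $\mathrm{BDIS}_t$ is exactly as hard as $\mathrm{ASG}_t$ with respect to $(\mu_0,\mu_1)$. Moreover, for all real $\alpha,\beta,\gamma$, there is an $(\alpha,\beta,\gamma)$-competitive algorithm for $\mathrm{BDIS}_t$ with respect to $(\mu_0,\mu_1)$ if and only if there is one for $\mathrm{ASG}_t$. -/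

import Mathlib

namespace OnlinePredictions

/-- A bit as a real number. -/
def bit (b : Bool) : ℝ := if b then 1 else 0

/-- A triple `(x, x̂, r)`: true bits `x`, predicted bits `xhat` and requests `r`, all of the same
length `n`. -/
structure Triple (R : Type) where
  n : ℕ
  x : Fin n → Bool
  xhat : Fin n → Bool
  r : Fin n → R

/-- Whether values are costs (to be minimized) or profits (to be maximized). -/
inductive Sense
  | minimize
  | maximize

/-- An online problem with binary predictions: the requests, which triples are instances, and the
cost or profit of answering a given triple with the bits `y`. -/
structure OnlineProblem where
  Request : Type
  sense : Sense
  IsInstance : Triple Request → Prop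
  value : (I : Triple Request) → (Fin I.n → Bool) → EReal

/-- The set of instances of `P`. -/
abbrev OnlineProblem.Inst (P : OnlineProblem) : Type := {I : Triple P.Request // P.IsInstance I}

/-- A deterministic online algorithm for `P`: its answer to a request depends only on the requests
and predictions received so far, including the current ones, listed in order of arrival. -/
abbrev OnlineProblem.Alg (P : OnlineProblem) : Type := List (P.Request × Bool) → Bool

/-- The bits output by the algorithm `A` on the triple `I`. -/
def OnlineProblem.output (P : OnlineProblem) (A : P.Alg) (I : Triple P.Request) :
    Fin I.n → Bool := fun i =>
  A (List.ofFn fun j : Fin (i.val + 1) =>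
    (I.r (Fin.castLE i.isLt j), I.xhat (Fin.castLE i.isLt j)))

/-- The cost or profit of the algorithm `A` on the triple `I`. -/
noncomputable def OnlineProblem.algValue (P : OnlineProblem) (A : P.Alg)
    (I : Triple P.Request) : EReal :=
  P.value I (P.output A I)

/-- The cost or profit of an optimal (offline) solution. -/
noncomputable def OnlineProblem.opt (P : OnlineProblem) (I : Triple P.Request) : EReal :=
  match P.sense with
  | Sense.minimize => ⨅ y, P.value I y
  | Sense.maximize => ⨆ y, P.value I y

/-- `a * v` for `0 ≤ a`, where an infinite value stays infinite even if `a = 0`; so an algorithm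
of profit `-∞` on an instance with finite optimum is never competitive. -/
noncomputable def scale (a : ℝ) (v : EReal) : EReal :=
  if v = ⊥ ∨ v = ⊤ then v else (a : EReal) * v

/-- `(α, β, γ)`-competitiveness of the algorithm `A` with respect to the error measures `(η₀, η₁)`,
for `α, β, γ` from the instances to `[0, ∞)`. -/
def OnlineProblem.Competitive (P : OnlineProblem) (η₀ η₁ : Triple P.Request → ℝ)
    (α β γ : P.Inst → ℝ) (A : P.Alg) : Prop :=
  (∀ I, 0 ≤ α I ∧ 0 ≤ β I ∧ 0 ≤ γ I) ∧
  ∃ κ : ℝ, ∀ I : P.Inst,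
    match P.sense with
    | Sense.minimize =>
        P.algValue A I.1 ≤
          scale (α I) (P.opt I.1) + ((β I * η₀ I.1 + γ I * η₁ I.1 + κ : ℝ) : EReal)
    | Sense.maximize =>
        P.opt I.1 ≤
          scale (α I) (P.algValue A I.1) + ((β I * η₀ I.1 + γ I * η₁ I.1 + κ : ℝ) : EReal)

/-- There is an `(α, β, γ)`-competitive algorithm for `P`, for constants `α, β, γ`. -/
def OnlineProblem.HasCompetitiveAlg (P : OnlineProblem) (η₀ η₁ : Triple P.Request → ℝ)
    (α β γ : ℝ) : Prop :=
  ∃ A : P.Alg, P.Competitive η₀ η₁ (fun _ => α) (fun _ => β) (fun _ => γ) A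

/-- `A` is an `(α, β, γ)`-competitive Pareto-optimal algorithm for `P`: none of the three
parameters can be decreased while the other two are kept. -/
def OnlineProblem.ParetoOptimal (P : OnlineProblem) (η₀ η₁ : Triple P.Request → ℝ)
    (α β γ : ℝ) (A : P.Alg) : Prop :=
  P.Competitive η₀ η₁ (fun _ => α) (fun _ => β) (fun _ => γ) A ∧
  ∀ ε : ℝ, 0 < ε →
    ¬ P.HasCompetitiveAlg η₀ η₁ (α - ε) β γ ∧
    ¬ P.HasCompetitiveAlg η₀ η₁ α (β - ε) γ ∧
    ¬ P.HasCompetitiveAlg η₀ η₁ α β (γ - ε)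

/-- `Q` with error measures `(φ₀, φ₁)` is (at least) as hard as `P` with error measures
`(η₀, η₁)`. -/
def AsHardAs (Q : OnlineProblem) (φ₀ φ₁ : Triple Q.Request → ℝ)
    (P : OnlineProblem) (η₀ η₁ : Triple P.Request → ℝ) : Prop :=
  ∀ α β γ : ℝ, (∃ A : Q.Alg, Q.ParetoOptimal φ₀ φ₁ α β γ A) → P.HasCompetitiveAlg η₀ η₁ α β γ

/-- `Q` is exactly as hard as `P`. -/
def ExactlyAsHardAs (Q : OnlineProblem) (φ₀ φ₁ : Triple Q.Request → ℝ)
    (P : OnlineProblem) (η₀ η₁ : Triple P.Request → ℝ) : Prop :=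
  AsHardAs Q φ₀ φ₁ P η₀ η₁ ∧ AsHardAs P η₀ η₁ Q φ₀ φ₁

/-- The canonical error measure `μ₀`: the number of wrong predictions equal to `0`. -/
noncomputable def mu0 {R : Type} (I : Triple R) : ℝ := ∑ i, bit (I.x i) * (1 - bit (I.xhat i))

/-- The canonical error measure `μ₁`: the number of wrong predictions equal to `1`. -/
noncomputable def mu1 {R : Type} (I : Triple R) : ℝ := ∑ i, (1 - bit (I.x i)) * bit (I.xhat i)

/-- `(1,t)`-Asymmetric String Guessing with Unknown History and Predictions. A request is a mere
prompt, carrying no information, and every pair of bitstrings of equal length is an instance. -/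
noncomputable def ASG (t : ℕ) : OnlineProblem where
  Request := Unit
  sense := Sense.minimize
  IsInstance := fun _ => True
  value := fun I y =>
    ((∑ i, (bit (y i) + (t : ℝ) * bit (I.x i) * (1 - bit (y i))) : ℝ) : EReal)

/-- The underlying graph of a sequence of vertex-arrival requests: the `i`-th request reveals the
vertex `i` together with the set `r i` of its neighbours among the earlier vertices. -/
def underlyingGraph (I : Triple (Finset ℕ)) : SimpleGraph (Fin I.n) :=
  SimpleGraph.fromRel fun i j => (j : ℕ) ∈ I.r i

open Classical in
/-- Online `t`-Bounded Degree Independent Set with Predictions. The answer `0` (`false`) accepts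
the current vertex. -/
noncomputable def BDIS (t : ℕ) : OnlineProblem where
  Request := Finset ℕ
  sense := Sense.maximize
  IsInstance := fun I =>
    (∀ i : Fin I.n, ∀ j ∈ I.r i, j < (i : ℕ)) ∧
    (∀ v : Fin I.n, ((underlyingGraph I).neighborSet v).ncard ≤ t) ∧
    (underlyingGraph I).IsMaximumIndepSet (Finset.univ.filter fun i => I.x i = false)
  value := fun I y =>
    if (underlyingGraph I).IsIndepSet {i | y i = false} then
      ((∑ i, (1 - bit (y i)) : ℝ) : EReal)
    else ⊥

end OnlinePredictions

namespace OnlinePredictions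

open Finset

@[simp] lemma bit_true : bit true = 1 := rfl

@[simp] lemma bit_false : bit false = 0 := rfl

lemma bit_nonneg (b : Bool) : 0 ≤ bit b := by cases b <;> simp

@[simp] lemma scale_coe (a v : ℝ) : scale a (v : EReal) = ((a * v : ℝ) : EReal) := by
  simp [scale]

@[simp] lemma scale_bot (a : ℝ) : scale a ⊥ = ⊥ := by simp [scale]

/-- The bits output by an algorithm on a triple, without reference to a problem. -/
def answers {R : Type} (A : List (R × Bool) → Bool) (I : Triple R) (i : Fin I.n) : Bool :=
  A (List.ofFn fun j : Fin (i.val + 1) =>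
    (I.r (Fin.castLE i.isLt j), I.xhat (Fin.castLE i.isLt j)))

/-- The parameters for which competitive algorithms exist, for both problems. -/
structure Feasible (t : ℕ) (α β γ : ℝ) : Prop where
  nonneg : 0 ≤ α ∧ 0 ≤ β ∧ 0 ≤ γ
  add_ge : (t : ℝ) ≤ α + β
  trade : (t : ℝ) ≤ α ∨ 1 ≤ α ∧ 1 ≤ γ

/-! ### Necessary conditions on the parameters -/

/-- If both coefficients were positive, the left side would be at least `min p q * m` however `m` is
split, hence unbounded. The split is chosen by the algorithm, so nothing else is known about it. -/
lemma nonneg_or_nonneg_of_forall_exists_le {p q κ : ℝ}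
    (h : ∀ m : ℕ, ∃ k l : ℕ, k + l = m ∧ p * k + q * l ≤ κ) : p ≤ 0 ∨ q ≤ 0 := by
  by_contra! hpq
  obtain ⟨hp, hq⟩ := hpq
  have hmin : 0 < min p q := lt_min hp hq
  obtain ⟨m, hm⟩ := exists_nat_gt (κ / min p q)
  obtain ⟨k, l, hkl, hle⟩ := h m
  rw [div_lt_iff₀ hmin] at hm
  have hk : min p q * k ≤ p * k := by gcongr; exact min_le_left _ _
  have hl : min p q * l ≤ q * l := by gcongr; exact min_le_right _ _
  have hm' : (k : ℝ) + l = m := by exact_mod_cast hkl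
  rw [← hm'] at hm
  linarith

/-- `h1` comes from error-free instances and forces `1 ≤ α`. In `h2`, `b = false` makes only `μ₀`
errors and bounds `α + β`; `b = true` makes only `μ₁` errors and yields the alternative between `α`
and `γ`. -/
lemma feasible_of_adversary {t : ℕ} {α β γ κ : ℝ} (h0 : 0 ≤ α ∧ 0 ≤ β ∧ 0 ≤ γ)
    (h1 : ∀ m : ℕ, (m : ℝ) ≤ α * m + κ)
    (h2 : ∀ (m : ℕ) (b : Bool), ∃ k l : ℕ, k + l = m ∧
      (t : ℝ) * k + l ≤ α * k + (β * (k * (1 - bit b)) + γ * (l * bit b) + κ)) :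
    Feasible t α β γ := by
  refine ⟨h0, ?_, ?_⟩
  · have : (t : ℝ) - α - β ≤ 0 ∨ (1 : ℝ) ≤ 0 := by
      refine nonneg_or_nonneg_of_forall_exists_le (κ := κ) fun m => ?_
      obtain ⟨k, l, hkl, h⟩ := h2 m false
      refine ⟨k, l, hkl, ?_⟩
      simp only [bit_false] at h
      linarith
    rcases this with h | h <;> linarith
  · have hα : 1 - α ≤ 0 ∨ 1 - α ≤ 0 := by
      refine nonneg_or_nonneg_of_forall_exists_le (κ := κ) fun m => ⟨m, 0, rfl, ?_⟩
      have := h1 m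
      push_cast
      linarith
    have : (t : ℝ) - α ≤ 0 ∨ 1 - γ ≤ 0 := by
      refine nonneg_or_nonneg_of_forall_exists_le (κ := κ) fun m => ?_
      obtain ⟨k, l, hkl, h⟩ := h2 m true
      refine ⟨k, l, hkl, ?_⟩
      simp only [bit_true] at h
      linarith
    have hα' : 1 - α ≤ 0 := hα.elim id id
    rcases this with h | h
    · exact Or.inl (by linarith)
    · exact Or.inr ⟨by linarith, by linarith⟩

/-! ### Asymmetric string guessing -/

lemma opt_ASG {t : ℕ} (ht : 0 < t) (I : Triple Unit) :
    (ASG t).opt I = ((∑ i, bit (I.x i) : ℝ) : EReal) := by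
  have ht' : (1 : ℝ) ≤ t := by exact_mod_cast ht
  apply le_antisymm
  · refine (iInf_le _ I.x).trans (EReal.coe_le_coe_iff.2 (sum_le_sum fun i _ => ?_))
    cases I.x i <;> simp
  · refine le_iInf fun y => EReal.coe_le_coe_iff.2 (sum_le_sum fun i _ => ?_)
    cases I.x i <;> cases y i <;> simp [ht']

lemma hasCompetitiveAlg_ASG_iff {t : ℕ} (ht : 0 < t) {α β γ : ℝ} :
    (ASG t).HasCompetitiveAlg mu0 mu1 α β γ ↔
      (0 ≤ α ∧ 0 ≤ β ∧ 0 ≤ γ) ∧ ∃ (A : List (Unit × Bool) → Bool) (κ : ℝ), ∀ I : Triple Unit,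
        ∑ i, (bit (answers A I i) + (t : ℝ) * bit (I.x i) * (1 - bit (answers A I i))) ≤
          α * ∑ i, bit (I.x i) + (β * mu0 I + γ * mu1 I + κ) := by
  have key (A : List (Unit × Bool) → Bool) (κ : ℝ) (I : Triple Unit) :
      ((ASG t).algValue A I ≤ scale α ((ASG t).opt I) +
        ((β * mu0 I + γ * mu1 I + κ : ℝ) : EReal)) ↔
      ∑ i, (bit (answers A I i) + (t : ℝ) * bit (I.x i) * (1 - bit (answers A I i))) ≤
          α * ∑ i, bit (I.x i) + (β * mu0 I + γ * mu1 I + κ) := by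
    rw [opt_ASG ht, scale_coe, ← EReal.coe_add, ← EReal.coe_le_coe_iff]
    rfl
  constructor
  · rintro ⟨A, h0, κ, h⟩
    -- Nonnegativity is quantified over instances, so some instance is needed; the empty one serves.
    exact ⟨h0 ⟨⟨0, Fin.elim0, Fin.elim0, Fin.elim0⟩, trivial⟩, A, κ,
      fun I => (key A κ I).1 (h ⟨I, trivial⟩)⟩
  · rintro ⟨h0, A, κ, h⟩
    exact ⟨A, fun _ => h0, κ, fun ⟨I, _⟩ => (key A κ I).2 (h I)⟩

/-- The answers to a run of identical requests with identical predictions. -/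
def constAnswers {R : Type} (A : List (R × Bool) → Bool) (r : R) (b : Bool) (i : ℕ) : Bool :=
  A (List.replicate (i + 1) (r, b))

lemma sum_bit_add_sum_not {m : ℕ} (y : Fin m → Bool) :
    ∃ k l : ℕ, k + l = m ∧ ∑ i, bit (!y i) = k ∧ ∑ i, bit (y i) = l := by
  refine ⟨#{i | y i = false}, #{i | y i = true}, ?_, ?_, ?_⟩
  · have := card_filter_add_card_filter_not (s := (univ : Finset (Fin m))) (fun i => y i = false)
    simpa using this
  · simp [bit, sum_boole]
  · simp [bit, sum_boole]

lemma feasible_of_hasCompetitiveAlg_ASG {t : ℕ} (ht : 0 < t) {α β γ : ℝ}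
    (h : (ASG t).HasCompetitiveAlg mu0 mu1 α β γ) : Feasible t α β γ := by
  obtain ⟨h0, A, κ, h⟩ := (hasCompetitiveAlg_ASG_iff ht).1 h
  have ht' : (1 : ℝ) ≤ t := by exact_mod_cast ht
  refine feasible_of_adversary h0 (κ := κ) (fun m => ?_) fun m b => ?_
  · have hI := h ⟨m, fun _ => true, fun _ => true, fun _ => ()⟩
    refine le_trans ?_ (hI.trans ?_)
    · calc (m : ℝ) = ∑ _i : Fin m, (1 : ℝ) := by simp
        _ ≤ _ := by
          have hy (y : Bool) : 1 ≤ bit y + (t : ℝ) * bit true * (1 - bit y) := by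
            cases y <;> simp [ht']
          exact sum_le_sum fun i _ => hy _
    · simp [mu0, mu1]
  · set y : Fin m → Bool := fun i => constAnswers A () b i with hy
    obtain ⟨k, l, hkl, hk, hl⟩ := sum_bit_add_sum_not y
    refine ⟨k, l, hkl, ?_⟩
    -- The truth may be defined from the answers because these depend only on the constant requests
    -- and predictions.
    have hI := h ⟨m, fun i => !y i, fun _ => b, fun _ => ()⟩
    have hout (i : Fin m) :
        answers A ⟨m, fun i => !y i, fun _ => b, fun _ => ()⟩ i = y i := by
      simp only [answers, hy, constAnswers, List.ofFn_const]
    simp only [mu0, mu1, hout] at hI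
    have e1 : ∑ i, (bit (y i) + (t : ℝ) * bit (!y i) * (1 - bit (y i))) = t * k + l := by
      rw [← hk, ← hl, mul_sum, ← sum_add_distrib]
      refine sum_congr rfl fun i _ => ?_
      cases y i <;> simp
    have e2 : ∑ i, (1 - bit (!y i)) * bit b = l * bit b := by
      rw [← hl, sum_mul]
      refine sum_congr rfl fun i _ => ?_
      cases y i <;> simp
    rw [e1, e2, ← sum_mul, hk] at hI
    exact hI

/-- The algorithm repeating the current prediction. -/
def followPrediction {R : Type} (L : List (R × Bool)) : Bool :=
  (L.getLast?.map Prod.snd).getD false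

lemma answers_followPrediction (I : Triple Unit) (i : Fin I.n) :
    answers followPrediction I i = I.xhat i := by
  simp only [answers, followPrediction, List.ofFn_succ_last]
  simp
  rfl

lemma hasCompetitiveAlg_ASG_of_feasible {t : ℕ} (ht : 0 < t) {α β γ : ℝ}
    (h : Feasible t α β γ) : (ASG t).HasCompetitiveAlg mu0 mu1 α β γ := by
  obtain ⟨⟨hα, hβ, hγ⟩, hadd, htα | ⟨hα1, hγ1⟩⟩ := h
  · refine (hasCompetitiveAlg_ASG_iff ht).2 ⟨⟨hα, hβ, hγ⟩, fun _ => false, 0, fun I => ?_⟩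
    simp only [answers, mu0, mu1, mul_sum, ← sum_add_distrib, add_zero]
    refine sum_le_sum fun i _ => ?_
    cases I.x i <;> cases I.xhat i <;> simp <;> linarith
  · refine (hasCompetitiveAlg_ASG_iff ht).2 ⟨⟨hα, hβ, hγ⟩, followPrediction, 0, fun I => ?_⟩
    simp only [answers_followPrediction, mu0, mu1, mul_sum, ← sum_add_distrib, add_zero]
    refine sum_le_sum fun i _ => ?_
    cases I.x i <;> cases I.xhat i <;> simp <;> linarith

/-! ### Bounded degree independent set: upper bounds -/

lemma sum_one_sub_bit {ι : Type*} [Fintype ι] (y : ι → Bool) :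
    ∑ i, (1 - bit (y i)) = (#{i | y i = false} : ℝ) := by
  rw [← sum_boole]
  refine sum_congr rfl fun i _ => ?_
  cases y i <;> simp

lemma underlyingGraph_adj {I : Triple (Finset ℕ)} {i j : Fin I.n} :
    (underlyingGraph I).Adj i j ↔ i ≠ j ∧ ((j : ℕ) ∈ I.r i ∨ (i : ℕ) ∈ I.r j) := by
  simp [underlyingGraph, SimpleGraph.fromRel_adj]

lemma opt_BDIS_le {t : ℕ} (I : Triple (Finset ℕ)) (hI : (BDIS t).IsInstance I) :
    (BDIS t).opt I ≤ ((#{i | I.x i = false} : ℝ) : EReal) := by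
  classical
  obtain ⟨-, -, hmax⟩ := hI
  refine iSup_le fun y => ?_
  simp only [BDIS]
  split_ifs with hy
  · rw [sum_one_sub_bit]
    have := hmax.2 ({i | y i = false} : Finset (Fin I.n)) (by simpa using hy)
    exact_mod_cast this
  · exact bot_le

lemma length_take_lt {α : Type*} {L : List α} (j : Fin (L.length - 1)) :
    (L.take (j + 1)).length < L.length := by
  have := j.isLt
  simp only [List.length_take]
  omega

/-- The greedy independent set algorithm restricted to vertices whose prediction satisfies `f`:
it accepts such a vertex unless an earlier neighbour has been accepted. -/
def greedy (f : Bool → Bool) (L : List (Finset ℕ × Bool)) : Bool :=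
  match L.getLast? with
  | none => true
  | some (r, b) =>
    -- The prefix of length `j + 1` is the history on which vertex `j` was decided.
    !(f b && decide (∀ j : Fin (L.length - 1), (j : ℕ) ∈ r → greedy f (L.take (j + 1)) = true))
termination_by L.length
decreasing_by
  all_goals exact length_take_lt _

lemma answers_greedy_eq_false (f : Bool → Bool) (I : Triple (Finset ℕ)) (i : Fin I.n) :
    answers (greedy f) I i = false ↔
      f (I.xhat i) = true ∧
        ∀ j : Fin I.n, j < i → (j : ℕ) ∈ I.r i → answers (greedy f) I j = true := by
  have htake (j : Fin I.n) (hj : j < i) :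
      (List.ofFn fun k : Fin (i.val + 1) =>
        (I.r (Fin.castLE i.isLt k), I.xhat (Fin.castLE i.isLt k))).take (j + 1) =
      List.ofFn fun k : Fin (j.val + 1) =>
        (I.r (Fin.castLE j.isLt k), I.xhat (Fin.castLE j.isLt k)) := by
    have : (j : ℕ) < i := hj
    apply List.ext_getElem
    · simp only [List.length_take, List.length_ofFn]
      omega
    · intro k h1 h2
      simp only [List.getElem_take, List.getElem_ofFn]
      rfl
  have hlast : (List.ofFn fun k : Fin (i.val + 1) =>
        (I.r (Fin.castLE i.isLt k), I.xhat (Fin.castLE i.isLt k))).getLast? =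
      some (I.r i, I.xhat i) := by
    rw [List.ofFn_succ_last]
    simp
    constructor <;> rfl
  conv_lhs => rw [answers, greedy]
  rw [hlast]
  simp only [Bool.not_eq_false', Bool.and_eq_true, decide_eq_true_eq]
  refine and_congr_right fun _ => ⟨fun h j hj hr => ?_, fun h j hr => ?_⟩
  · have := h ⟨j, by simpa using hj⟩ hr
    rwa [htake j hj] at this
  · have hj : (j : ℕ) < i := by simpa using j.isLt
    have := h ⟨j, hj.trans i.isLt⟩ hj hr
    rwa [answers, ← htake ⟨j, hj.trans i.isLt⟩ hj] at this

lemma isIndepSet_greedy {t : ℕ} (f : Bool → Bool) (I : Triple (Finset ℕ)) (hI : (BDIS t).IsInstance I) :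
    (underlyingGraph I).IsIndepSet {i | answers (greedy f) I i = false} := by
  intro i hi j hj _ hadj
  have hlt := hI.1
  rw [underlyingGraph_adj] at hadj
  rw [Set.mem_ofPred_eq, answers_greedy_eq_false] at hi hj
  rcases hadj.2 with h | h
  · have := hi.2 j (hlt i _ h) h
    have := (answers_greedy_eq_false f I j).2 hj
    simp_all
  · have := hj.2 i (hlt j _ h) h
    have := (answers_greedy_eq_false f I i).2 hi
    simp_all

/-- An optimal vertex that is neither accepted nor filtered out has an earlier accepted neighbour.
That neighbour lies outside the optimum, by independence, and is charged at most `t` times, by the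
degree bound. -/
lemma card_le_greedy {t : ℕ} (f : Bool → Bool) (I : Triple (Finset ℕ)) (hI : (BDIS t).IsInstance I) :
    #{i | I.x i = false} ≤
      #{i | answers (greedy f) I i = false ∧ I.x i = false} +
      #{i | I.x i = false ∧ f (I.xhat i) = false} +
      #{i | answers (greedy f) I i = false ∧ I.x i = true} * t := by
  classical
  obtain ⟨hlt, hdeg, hmax⟩ := hI
  set y := answers (greedy f) I with hy
  set B : Finset (Fin I.n) := {i | y i = false ∧ I.x i = true} with hB
  have hsub : ({i | I.x i = false} : Finset (Fin I.n)) ⊆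
      (({i | y i = false ∧ I.x i = false} : Finset (Fin I.n)) ∪
        ({i | I.x i = false ∧ f (I.xhat i) = false} : Finset (Fin I.n))) ∪
      B.biUnion fun a => (underlyingGraph I).neighborFinset a := by
    intro i hi
    simp only [mem_filter, mem_univ, true_and] at hi
    by_cases hyi : y i = false
    · simp [hyi, hi]
    by_cases hf : f (I.xhat i) = false
    · simp [hf, hi]
    have := mt (answers_greedy_eq_false f I i).2 hyi
    push Not at this
    obtain ⟨j, hji, hjr, hj⟩ := this (by simpa using hf)
    have hadj : (underlyingGraph I).Adj j i := underlyingGraph_adj.2 ⟨hji.ne, Or.inr hjr⟩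
    have hxj : I.x j = true := by
      by_contra hxj
      exact hmax.1 (by simpa using hxj) (by simpa using hi) hji.ne hadj
    refine mem_union_right _ (mem_biUnion.2 ⟨j, ?_, by simpa using hadj⟩)
    simpa [hB, hxj] using hj
  refine (card_le_card hsub).trans ((card_union_le _ _).trans
    (add_le_add (card_union_le _ _) (card_biUnion_le_card_mul _ _ _ fun a _ => ?_)))
  have := hdeg a
  rwa [Set.ncard_eq_toFinset_card'] at this

lemma competitive_greedy {t : ℕ} {α β γ : ℝ} (h0 : 0 ≤ α ∧ 0 ≤ β ∧ 0 ≤ γ) (f : Bool → Bool)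
    (h : ∀ I : Triple (Finset ℕ), (BDIS t).IsInstance I → (#{i | I.x i = false} : ℝ) ≤
      α * #{i | answers (greedy f) I i = false} + (β * mu0 I + γ * mu1 I)) :
    (BDIS t).HasCompetitiveAlg mu0 mu1 α β γ := by
  refine ⟨greedy f, fun _ => h0, 0, fun ⟨I, hI⟩ => ?_⟩
  change (BDIS t).opt I ≤ scale α ((BDIS t).algValue (greedy f) I) + _
  have hv : (BDIS t).algValue (greedy f) I =
      ((#{i | answers (greedy f) I i = false} : ℝ) : EReal) := by
    rw [← sum_one_sub_bit]
    exact if_pos (isIndepSet_greedy f I hI)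
  rw [hv, scale_coe, ← EReal.coe_add, add_zero]
  exact (opt_BDIS_le I hI).trans (EReal.coe_le_coe_iff.2 (h I hI))

lemma mu0_eq_card {R : Type} (I : Triple R) :
    mu0 I = (#{i | I.x i = true ∧ I.xhat i = false} : ℝ) := by
  rw [mu0, ← sum_boole]
  refine sum_congr rfl fun i _ => ?_
  cases I.x i <;> cases I.xhat i <;> simp

lemma mu1_eq_card {R : Type} (I : Triple R) :
    mu1 I = (#{i | I.x i = false ∧ I.xhat i = true} : ℝ) := by
  rw [mu1, ← sum_boole]
  refine sum_congr rfl fun i _ => ?_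
  cases I.x i <;> cases I.xhat i <;> simp

lemma hasCompetitiveAlg_BDIS_of_feasible {t : ℕ} (ht : 0 < t) {α β γ : ℝ}
    (h : Feasible t α β γ) : (BDIS t).HasCompetitiveAlg mu0 mu1 α β γ := by
  have ht' : (1 : ℝ) ≤ t := by exact_mod_cast ht
  have hsplit (f : Bool → Bool) (I : Triple (Finset ℕ)) :
      (#{i | answers (greedy f) I i = false} : ℝ) =
        #{i | answers (greedy f) I i = false ∧ I.x i = false} +
        #{i | answers (greedy f) I i = false ∧ I.x i = true} := by
    have := card_filter_add_card_filter_not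
      (s := ({i | answers (greedy f) I i = false} : Finset (Fin I.n)))
      (fun i => I.x i = false)
    simp only [filter_filter, Bool.not_eq_false] at this
    exact_mod_cast this.symm
  obtain ⟨⟨hα, hβ, hγ⟩, hadd, htα | ⟨hα1, hγ1⟩⟩ := h
  · refine competitive_greedy ⟨hα, hβ, hγ⟩ (fun _ => true) fun I hI => ?_
    have hc := card_le_greedy (fun _ => true) I hI
    simp only [Bool.true_eq_false, and_false, filter_false, card_empty, add_zero] at hc
    have hc' := (Nat.cast_le (α := ℝ)).2 hc
    rw [hsplit, mu0_eq_card, mu1_eq_card]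
    push_cast at hc'
    refine hc'.trans ?_
    rw [mul_add, mul_comm _ (t : ℝ)]
    refine le_add_of_le_of_nonneg (add_le_add ?_ ?_) (by positivity)
    · exact le_mul_of_one_le_left (by positivity) (ht'.trans htα)
    · gcongr
  · refine competitive_greedy ⟨hα, hβ, hγ⟩ (fun b => !b) fun I hI => ?_
    have hc := card_le_greedy (fun b => !b) I hI
    simp only [Bool.not_eq_false'] at hc
    have hc' := (Nat.cast_le (α := ℝ)).2 hc
    -- Only vertices predicted 0 are accepted, so each wrongly accepted vertex is a `μ₀` error; its
    -- charge `t ≤ α + β` is paid by its own profit and that error.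
    have hsub : #{i | answers (greedy fun b => !b) I i = false ∧ I.x i = true} ≤
        #{i | I.x i = true ∧ I.xhat i = false} := by
      refine card_le_card fun i hi => ?_
      simp only [mem_filter, mem_univ, true_and, answers_greedy_eq_false] at hi ⊢
      exact ⟨hi.2, by simpa using hi.1.1⟩
    have hsub' := (Nat.cast_le (α := ℝ)).2 hsub
    rw [hsplit, mu0_eq_card, mu1_eq_card]
    push_cast at hc'
    refine hc'.trans ?_
    set a := #{i | answers (greedy fun b => !b) I i = false ∧ I.x i = true}
    set p := #{i | answers (greedy fun b => !b) I i = false ∧ I.x i = false}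
    have h1 : (p : ℝ) ≤ α * p := le_mul_of_one_le_left (by positivity) hα1
    have h2 := le_mul_of_one_le_left
      (Nat.cast_nonneg (α := ℝ) #{i | I.x i = false ∧ I.xhat i = true}) hγ1
    have h3 := mul_le_mul_of_nonneg_left hsub' hβ
    have h4 := mul_le_mul_of_nonneg_right hadd (Nat.cast_nonneg (α := ℝ) a)
    linarith

/-! ### Bounded degree independent set: lower bounds -/

/-- A numbering of `t` leaves for every centre in `S`. -/
noncomputable def leafEquiv {m : ℕ} (S : Finset (Fin m)) (t : ℕ) :
    S × Fin t ≃ Fin (#S * t) :=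
  Fintype.equivFinOfCardEq (by simp)

/-- `m` isolated vertices, all with prediction `b`, followed by `t` leaves attached to each of
those in `S`, with prediction `0`. The vertices in `S` have true bit `1`, all others `0`. -/
noncomputable def starForest {m : ℕ} (S : Finset (Fin m)) (t : ℕ) (b : Bool) :
    Triple (Finset ℕ) where
  n := m + #S * t
  x := Fin.append (fun i => decide (i ∈ S)) (fun _ => false)
  xhat := Fin.append (fun _ => b) (fun _ => false)
  r := Fin.append (fun _ => ∅) (fun j => {(((leafEquiv S t).symm j).1.1 : ℕ)})

namespace starForest

variable {m t : ℕ} {S : Finset (Fin m)} {b : Bool}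

/-- The centres and leaves of a star forest, in order of arrival. -/
noncomputable def vertex {m : ℕ} (S : Finset (Fin m)) (t : ℕ) (b : Bool) :
    Fin m ⊕ S × Fin t ≃ Fin (starForest S t b).n :=
  (Equiv.sumCongr (Equiv.refl _) (leafEquiv S t)).trans finSumFinEquiv

@[simp] lemma x_centre (i : Fin m) :
    (starForest S t b).x (vertex S t b (Sum.inl i)) = decide (i ∈ S) :=
  Fin.append_left (fun i => decide (i ∈ S)) (fun _ : Fin (#S * t) => false) i

@[simp] lemma x_leaf (q : S × Fin t) :
    (starForest S t b).x (vertex S t b (Sum.inr q)) = false :=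
  Fin.append_right (fun i => decide (i ∈ S)) (fun _ : Fin (#S * t) => false) (leafEquiv S t q)

@[simp] lemma xhat_centre (i : Fin m) :
    (starForest S t b).xhat (vertex S t b (Sum.inl i)) = b :=
  Fin.append_left (fun _ => b) (fun _ : Fin (#S * t) => false) i

@[simp] lemma xhat_leaf (q : S × Fin t) :
    (starForest S t b).xhat (vertex S t b (Sum.inr q)) = false :=
  Fin.append_right (fun _ : Fin m => b) (fun _ => false) (leafEquiv S t q)

@[simp] lemma r_centre (i : Fin m) :
    (starForest S t b).r (vertex S t b (Sum.inl i)) = ∅ :=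
  Fin.append_left (fun _ => ∅)
    (fun j : Fin (#S * t) => {(((leafEquiv S t).symm j).1.1 : ℕ)}) i

@[simp] lemma r_leaf (q : S × Fin t) :
    (starForest S t b).r (vertex S t b (Sum.inr q)) = {(q.1.1 : ℕ)} :=
  (Fin.append_right (fun _ : Fin m => ∅)
    (fun j : Fin (#S * t) => {(((leafEquiv S t).symm j).1.1 : ℕ)}) (leafEquiv S t q)).trans
    (by simp)

@[simp] lemma val_centre (i : Fin m) : (vertex S t b (Sum.inl i) : ℕ) = i := rfl

lemma le_val_leaf (q : S × Fin t) : m ≤ (vertex S t b (Sum.inr q) : ℕ) :=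
  Nat.le_add_right m _

lemma forall_vertex {p : Fin (starForest S t b).n → Prop} :
    (∀ v, p v) ↔ (∀ i, p (vertex S t b (Sum.inl i))) ∧ ∀ q, p (vertex S t b (Sum.inr q)) := by
  rw [← (vertex S t b).forall_congr_right, Sum.forall]

lemma not_adj_centre_centre (i j : Fin m) :
    ¬ (underlyingGraph (starForest S t b)).Adj (vertex S t b (Sum.inl i))
      (vertex S t b (Sum.inl j)) := by
  simp [underlyingGraph_adj]

lemma adj_centre_leaf (i : Fin m) (q : S × Fin t) :
    (underlyingGraph (starForest S t b)).Adj (vertex S t b (Sum.inl i))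
      (vertex S t b (Sum.inr q)) ↔ i = q.1 := by
  simp [underlyingGraph_adj, Fin.ext_iff (a := i)]

lemma not_adj_leaf_leaf (q q' : S × Fin t) :
    ¬ (underlyingGraph (starForest S t b)).Adj (vertex S t b (Sum.inr q))
      (vertex S t b (Sum.inr q')) := by
  have h := le_val_leaf (b := b) q
  have h' := le_val_leaf (b := b) q'
  have := q.1.1.isLt
  have := q'.1.1.isLt
  simp only [underlyingGraph_adj, r_leaf, mem_singleton]
  omega

lemma ncard_neighborSet_le (ht : 0 < t) (v : Fin (starForest S t b).n) :
    ((underlyingGraph (starForest S t b)).neighborSet v).ncard ≤ t := by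
  revert v
  refine forall_vertex.2 ⟨fun i => ?_, fun q => ?_⟩
  · by_cases hi : i ∈ S
    · have hsub : (underlyingGraph (starForest S t b)).neighborSet (vertex S t b (Sum.inl i)) ⊆
          (fun l => vertex S t b (Sum.inr (⟨i, hi⟩, l))) '' Set.univ := by
        refine forall_vertex.2 ⟨fun j hj => absurd hj (not_adj_centre_centre i j),
          fun q hq => ⟨q.2, trivial, ?_⟩⟩
        have := (adj_centre_leaf i q).1 hq
        subst this
        rfl
      refine (Set.ncard_le_ncard hsub (Set.toFinite _)).trans
        ((Set.ncard_image_le (Set.toFinite _)).trans ?_)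
      simp [Set.ncard_univ]
    · have : (underlyingGraph (starForest S t b)).neighborSet (vertex S t b (Sum.inl i)) = ∅ := by
        refine Set.eq_empty_iff_forall_notMem.2 (forall_vertex.2
          ⟨fun j hj => not_adj_centre_centre i j hj, fun q hq => hi ?_⟩)
        rw [(adj_centre_leaf i q).1 hq]
        exact q.1.2
      simp [this]
  · have hsub : (underlyingGraph (starForest S t b)).neighborSet (vertex S t b (Sum.inr q)) ⊆
        {vertex S t b (Sum.inl q.1.1)} := by
      refine forall_vertex.2 ⟨fun j hj => ?_, fun q' hq => absurd hq (not_adj_leaf_leaf q q')⟩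
      rw [(adj_centre_leaf j q).1 hj.symm]
      rfl
    refine (Set.ncard_le_ncard hsub (Set.toFinite _)).trans ?_
    rw [Set.ncard_singleton]
    exact ht

lemma isInstance (ht : 0 < t) : (BDIS t).IsInstance (starForest S t b) := by
  classical
  change (∀ i : Fin (starForest S t b).n, ∀ j ∈ (starForest S t b).r i, j < (i : ℕ)) ∧
    (∀ v : Fin (starForest S t b).n,
      ((underlyingGraph (starForest S t b)).neighborSet v).ncard ≤ t) ∧
    (underlyingGraph (starForest S t b)).IsMaximumIndepSet _
  refine ⟨forall_vertex.2 ⟨by simp, fun q j hj => ?_⟩, ncard_neighborSet_le ht, ?_,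
    fun T hT => ?_⟩
  · rw [r_leaf, mem_singleton] at hj
    have := le_val_leaf (b := b) q
    omega
  · simp only [coe_filter, mem_univ, true_and]
    have h1 (i : Fin m) (q : S × Fin t)
        (hi : (starForest S t b).x (vertex S t b (Sum.inl i)) = false) :
        ¬ (underlyingGraph (starForest S t b)).Adj (vertex S t b (Sum.inl i))
          (vertex S t b (Sum.inr q)) := by
      rw [adj_centre_leaf]
      rintro rfl
      simp at hi
    refine forall_vertex.2 ⟨fun i hi => forall_vertex.2 ⟨fun j _ _ => not_adj_centre_centre i j,
      fun q _ _ => h1 i q hi⟩, fun q _ => forall_vertex.2 ⟨fun i hi _ h => h1 i q hi h.symm,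
      fun q' _ _ => not_adj_leaf_leaf q q'⟩⟩
  -- Maximality: moving each centre in `S` to its first leaf maps an independent set `T` into the
  -- claimed optimum, injectively since `T` never contains a centre together with one of its leaves.
  · let g : Fin m ⊕ S × Fin t → Fin m ⊕ S × Fin t := Sum.elim
      (fun i => if h : i ∈ S then Sum.inr (⟨i, h⟩, ⟨0, ht⟩) else Sum.inl i) Sum.inr
    have hT' (i : Fin m) (q : S × Fin t) (hi : vertex S t b (Sum.inl i) ∈ T)
        (hq : vertex S t b (Sum.inr q) ∈ T) : i ≠ q.1 := fun h =>
      hT hi hq (by simp) ((adj_centre_leaf i q).2 h)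
    refine card_le_card_of_injOn (fun v => vertex S t b (g ((vertex S t b).symm v)))
      (fun v _ => ?_) ?_
    · revert v
      refine forall_vertex.2 ⟨fun i _ => ?_, fun q _ => by simp [g]⟩
      by_cases hi : i ∈ S <;> simp [g, hi]
    · have h1 (i : Fin m) (q : S × Fin t) (hi : vertex S t b (Sum.inl i) ∈ T)
          (hq : vertex S t b (Sum.inr q) ∈ T) : g (Sum.inl i) ≠ Sum.inr q := by
        have := hT' i q hi hq
        by_cases hiS : i ∈ S
        · simp only [g, Sum.elim_inl, hiS, dite_true, ne_eq, Sum.inr.injEq]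
          rintro rfl
          exact this rfl
        · simp [g, hiS]
      refine forall_vertex.2 ⟨fun i hi => forall_vertex.2 ⟨fun j _ h => ?_, fun q hq h => ?_⟩,
        fun q hq => forall_vertex.2 ⟨fun i hi h => ?_, fun q' _ h => ?_⟩⟩
      · by_cases hi : i ∈ S <;> by_cases hj : j ∈ S <;> simp_all [g]
      · exact absurd (by simpa [g] using h) (h1 i q hi hq)
      · exact absurd (by simpa [g] using h.symm) (h1 i q hi hq)
      · simpa [g] using h

lemma sum_vertex (f : Fin (starForest S t b).n → ℝ) :
    ∑ v, f v = ∑ i, f (vertex S t b (Sum.inl i)) + ∑ q, f (vertex S t b (Sum.inr q)) := by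
  rw [← (vertex S t b).sum_comp, Fintype.sum_sum_type]

/-- The centres arrive first and look alike, so their answers do not depend on `S`. Hence `S` can be
chosen afterwards as the set of accepted centres. -/
lemma answers_centre (A : List (Finset ℕ × Bool) → Bool) (i : Fin m) :
    answers A (starForest S t b) (vertex S t b (Sum.inl i)) = constAnswers A ∅ b i := by
  rw [constAnswers, ← List.ofFn_const, answers]
  congr 2
  funext j
  have hj : j.val < i.val + 1 := j.isLt
  exact Prod.ext (r_centre (S := S) (t := t) (b := b) ⟨j, hj.trans_le i.isLt⟩)
    (xhat_centre (S := S) (t := t) (b := b) ⟨j, hj.trans_le i.isLt⟩)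

lemma sum_bit_mem : ∑ i : Fin m, bit (decide (i ∈ S)) = #S := by
  simp [bit]

end starForest

lemma hasCompetitiveAlg_BDIS_imp {t : ℕ} {α β γ : ℝ}
    (h : (BDIS t).HasCompetitiveAlg mu0 mu1 α β γ) :
    ∃ (A : List (Finset ℕ × Bool) → Bool) (κ : ℝ), ∀ I : Triple (Finset ℕ), (BDIS t).IsInstance I →
      (0 ≤ α ∧ 0 ≤ β ∧ 0 ≤ γ) ∧ (underlyingGraph I).IsIndepSet {i | answers A I i = false} ∧
      ∑ i, (1 - bit (I.x i)) ≤
        α * ∑ i, (1 - bit (answers A I i)) + (β * mu0 I + γ * mu1 I + κ) := by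
  obtain ⟨A, h0, κ, h⟩ := h
  refine ⟨A, κ, fun I hI => ⟨h0 ⟨I, hI⟩, ?_⟩⟩
  have hle : ((∑ i, (1 - bit (I.x i)) : ℝ) : EReal) ≤ (BDIS t).opt I := by
    have hx : (underlyingGraph I).IsIndepSet {i | I.x i = false} := by
      simpa using hI.2.2.1
    have : (BDIS t).value I I.x = ((∑ i, (1 - bit (I.x i)) : ℝ) : EReal) := if_pos hx
    rw [← this]
    exact le_iSup ((BDIS t).value I) I.x
  have hcomp : (BDIS t).opt I ≤ scale α ((BDIS t).algValue A I) +
    ((β * mu0 I + γ * mu1 I + κ : ℝ) : EReal) := h ⟨I, hI⟩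
  by_cases hind : (underlyingGraph I).IsIndepSet {i | answers A I i = false}
  · have hv : (BDIS t).algValue A I = ((∑ i, (1 - bit (answers A I i)) : ℝ) : EReal) := if_pos hind
    rw [hv, scale_coe, ← EReal.coe_add] at hcomp
    exact ⟨hind, EReal.coe_le_coe_iff.1 (hle.trans hcomp)⟩
  -- A dependent answer set has profit `-∞`, which `scale` preserves even for `α = 0`, contradicting
  -- the finite lower bound on the optimum.
  · have hv : (BDIS t).algValue A I = ⊥ := if_neg hind
    rw [hv, scale_bot, EReal.bot_add] at hcomp
    exact absurd (le_bot_iff.1 (hle.trans hcomp)) (EReal.coe_ne_bot _)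

lemma feasible_of_hasCompetitiveAlg_BDIS {t : ℕ} (ht : 0 < t) {α β γ : ℝ}
    (h : (BDIS t).HasCompetitiveAlg mu0 mu1 α β γ) : Feasible t α β γ := by
  obtain ⟨A, κ, h⟩ := hasCompetitiveAlg_BDIS_imp h
  have h0 := (h _ (starForest.isInstance (S := (∅ : Finset (Fin 0))) (b := false) ht)).1
  refine feasible_of_adversary (κ := κ) h0 (fun m => ?_) fun m b => ?_
  · obtain ⟨-, -, hle⟩ :=
      h _ (starForest.isInstance (S := (∅ : Finset (Fin m))) (b := false) ht)
    simp only [mu0, mu1, starForest.sum_vertex] at hle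
    simp at hle
    refine hle.trans (add_le_add_left (mul_le_mul_of_nonneg_left ?_ h0.1) _)
    have := sum_nonneg fun (i : Fin m) (_ : i ∈ univ) => bit_nonneg
      (answers A (starForest ∅ t false) (starForest.vertex ∅ t false (Sum.inl i)))
    linarith
  · set y : Fin m → Bool := fun i => constAnswers A ∅ b i with hy
    obtain ⟨k, l, hkl, hk, hl⟩ := sum_bit_add_sum_not y
    refine ⟨k, l, hkl, ?_⟩
    set S : Finset (Fin m) := {i | y i = false} with hS
    obtain ⟨-, hind, hle⟩ := h _ (starForest.isInstance (S := S) (b := b) ht)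
    -- Every leaf hangs on an accepted centre, so the algorithm must reject it and earns only `k`,
    -- against an optimum of `t * k + l`.
    have hleaf (q : S × Fin t) :
        answers A (starForest S t b) (starForest.vertex S t b (Sum.inr q)) = true := by
      by_contra hq
      refine hind ?_ (by simpa using hq) (by simp) ((starForest.adj_centre_leaf q.1.1 q).2 rfl)
      have := (mem_filter.1 q.1.2)
      rw [Set.mem_ofPred_eq, starForest.answers_centre]
      exact this.2
    have hdec (i : Fin m) : decide (i ∈ S) = !y i := by
      simp only [hS, mem_filter, mem_univ, true_and]
      cases y i <;> rfl
    have hcard : (#S : ℝ) = k := by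
      rw [← hk, ← starForest.sum_bit_mem]
      simp only [hdec]
    have hnot (i : Fin m) : 1 - bit (!y i) = bit (y i) := by cases y i <;> simp
    have hnot' (i : Fin m) : 1 - bit (y i) = bit (!y i) := by cases y i <;> simp
    have hy' (i : Fin m) : constAnswers A ∅ b i = y i := rfl
    simp only [mu0, mu1, starForest.sum_vertex, starForest.x_centre, starForest.x_leaf,
      starForest.xhat_centre, starForest.xhat_leaf, starForest.answers_centre, hleaf, hdec, hy',
      hnot, hnot', ← sum_mul, hk, hl] at hle
    simp [hcard] at hle
    linarith

end OnlinePredictions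

theorem mainTheorem1 (t : ℕ) (ht : 0 < t) :
    OnlinePredictions.ExactlyAsHardAs
      (OnlinePredictions.BDIS t) OnlinePredictions.mu0 OnlinePredictions.mu1
      (OnlinePredictions.ASG t) OnlinePredictions.mu0 OnlinePredictions.mu1 ∧
    ∀ α β γ : ℝ,
      (OnlinePredictions.BDIS t).HasCompetitiveAlg
          OnlinePredictions.mu0 OnlinePredictions.mu1 α β γ ↔
        (OnlinePredictions.ASG t).HasCompetitiveAlg
          OnlinePredictions.mu0 OnlinePredictions.mu1 α β γ := by
  have key : ∀ α β γ : ℝ,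
      (OnlinePredictions.BDIS t).HasCompetitiveAlg
          OnlinePredictions.mu0 OnlinePredictions.mu1 α β γ ↔
        (OnlinePredictions.ASG t).HasCompetitiveAlg
          OnlinePredictions.mu0 OnlinePredictions.mu1 α β γ := fun α β γ =>
    ⟨fun h => OnlinePredictions.hasCompetitiveAlg_ASG_of_feasible ht
        (OnlinePredictions.feasible_of_hasCompetitiveAlg_BDIS ht h),
      fun h => OnlinePredictions.hasCompetitiveAlg_BDIS_of_feasible ht
        (OnlinePredictions.feasible_of_hasCompetitiveAlg_ASG ht h)⟩
  -- Only the competitiveness half of Pareto-optimality is needed.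
  exact ⟨⟨fun α β γ ⟨A, hA⟩ => (key α β γ).1 ⟨A, hA.1⟩,
    fun α β γ ⟨A, hA⟩ => (key α β γ).2 ⟨A, hA.1⟩⟩, key⟩
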